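/- **Definitions.** An *AQS automaton* consists of a finite set $S$ of states, maps $F^-,F^+:S\to\mathbb R\cup\{-\infty,+\infty\}$ and maps $U,D:S\to S$ such that for all $\sigma\in S$: $F^-[\sigma]<F^+[\sigma]$; $F^+[U\sigma]>F^+[\sigma]$ if $U\sigma\ne\sigma$; $F^-[U\sigma]<F^+[\sigma]$; $F^-[D\sigma]<F^-[\sigma]$ if $D\sigma\neq\sigma$; $F^+[D\sigma]>F^-[\sigma]$. Moreover $U$ has precisely one fixed point $\omega$, $D$ has precisely one fixed point $\alpha$, and $F^+[\omega]=+\infty$, $F^-[\alpha]=-\infty$. Let $U^*\sigma=\{U^i\sigma: i\ge 0\}$ and $D^*\sigma=\{D^i\sigma: i\ge 0\}$. Write $\mu\prec_U\nu$ if $\nu\in U^*\mu$ and $\mu\ne\nu$; $\mu\prec_D\nu$ if $\mu\in D^*\nu$ and $\mu\neq\nu$; and $\mu<\nu$ if both $\mu\prec_U\nu$ and $\mu\prec_D\nu$. The automaton is an *$\ell$AQS automaton* if it has the loop return point memory property: for all states with $\mu<\nu$, $\mu\prec_U\sigma\prec_U\nu$ implies $\mu<\sigma$, and $\mu\prec_D\sigma\prec_D\nu$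 implies $\sigma<\nu$. A pair $(\mu,\nu)$ is a *loop* if $\nu\in U^*\mu$ and $\mu\in D^*\nu$ (the singleton loop $\mu=\nu$ is allowed). A *$(\mu,\nu)$-confined field-history* is a finite, possibly empty, sequence of applications of $U$ and $D$ that starts from $\mu$ or from $\nu$, whose first step (if any) is not $U$ if it starts from $\nu$ and not $D$ if it starts from $\mu$, and all of whose states strictly between the initial and the final one differ from $\mu$ and $\nu$. (For $\mu=\nu$ only the empty field-history is confined.) The set $\mathcal R_{\mu,\nu}$ of *$(\mu,\nu)$-reachable states* is the set of final states of $(\mu,\nu)$-confined field-histories. The *state transition graph* on $\mathcal R_{\mu,\nu}$ is the multigraph with vertex set $\mathcal R_{\mu,\nu}$ that has, for each $\sigma\in\mathcal R_{\mu,\nu}$, one edge from $\sigma$ to $U\sigma$ if $U\sigma\in\mathcal R_{\mu,\nu}$, and one edge from $\sigma$ to $D\sigma$ if $D\sigma\in\mathcal R_{\mu,\nu}$. A multigraph is *planar* if it can be drawn in the Euclidean plane with vertices as distinct points and edges as simple arcs (simple closed curves for edges from a vertex to itself) joining their ends, so that the interior of an edge contains no vertex and meets no other edge. **Theorem (Planarity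 of the state transition graph associated with a loop).** Let $(\mu,\nu)$ be a loop of an $\ell$AQS automaton. Then the state transition graph on the set $\mathcal R_{\mu,\nu}$ of $(\mu,\nu)$-reachable states is planar. -/

import Mathlib

/-- An AQS automaton `(S, F⁻, F⁺, U, D)`: a finite set of configurations with trapping fields and
the transition maps `U` (field increase) and `D` (field decrease), compatible with each other.
Each of the two maps has precisely one fixed point, the absorbing states `omega` and `alpha`. -/
structure AQSAutomaton (S : Type*) where
  finite : Finite S
  Fminus : S → EReal
  Fplus : S → EReal
  U : S → S
  D : S → S
  Fminus_lt_Fplus : ∀ σ, Fminus σ < Fplus σ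
  Fplus_lt_Fplus_U : ∀ σ, U σ ≠ σ → Fplus σ < Fplus (U σ)
  Fminus_U_lt_Fplus : ∀ σ, Fminus (U σ) < Fplus σ
  Fminus_D_lt_Fminus : ∀ σ, D σ ≠ σ → Fminus (D σ) < Fminus σ
  Fminus_lt_Fplus_D : ∀ σ, Fminus σ < Fplus (D σ)
  omega : S
  alpha : S
  U_eq_self_iff : ∀ σ, U σ = σ ↔ σ = omega
  D_eq_self_iff : ∀ σ, D σ = σ ↔ σ = alpha
  Fplus_omega : Fplus omega = ⊤
  Fminus_alpha : Fminus alpha = ⊥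

/-- The two kinds of transitions. -/
inductive AQSStep
  | up
  | down

namespace AQSAutomaton

variable {S : Type*} (A : AQSAutomaton S)

/-- The `U`-orbit `U^*σ`, as a set. -/
def orbitU (σ : S) : Set S := {η | ∃ i : ℕ, η = A.U^[i] σ}

/-- The `D`-orbit `D^*σ`, as a set. -/
def orbitD (σ : S) : Set S := {η | ∃ i : ℕ, η = A.D^[i] σ}

/-- The dynamic order `μ ⪯_U ν`. -/
def leU (μ ν : S) : Prop := ν ∈ A.orbitU μ

/-- The dynamic order `μ ⪯_D ν`. -/
def leD (μ ν : S) : Prop := μ ∈ A.orbitD ν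

/-- The strict dynamic order `μ ≺_U ν`. -/
def ltU (μ ν : S) : Prop := A.leU μ ν ∧ μ ≠ ν

/-- The strict dynamic order `μ ≺_D ν`. -/
def ltD (μ ν : S) : Prop := A.leD μ ν ∧ μ ≠ ν

/-- The loop partial order `μ < ν`. -/
def loopLt (μ ν : S) : Prop := A.ltU μ ν ∧ A.ltD μ ν

/-- The loop return point memory property (ℓRPM). -/
def HasLoopRPM : Prop :=
  ∀ μ ν σ : S, A.loopLt μ ν →
    (A.ltU μ σ → A.ltU σ ν → A.loopLt μ σ) ∧ (A.ltD μ σ → A.ltD σ ν → A.loopLt σ ν)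

/-- `(μ, ν)` are the endpoints of a loop. The case `μ = ν` is the singleton loop. -/
def IsLoop (μ ν : S) : Prop := ν ∈ A.orbitU μ ∧ μ ∈ A.orbitD ν

/-- The transition of a given kind out of a state. -/
def step : AQSStep → S → S
  | .up => A.U
  | .down => A.D

/-- The final state of a field-history, a finite sequence of `U`- and `D`-transitions applied from
left to right, that starts in `σ`. -/
def run (Φ : List AQSStep) (σ : S) : S := Φ.foldl (fun x s => A.step s x) σ

/-- `Φ` is a `(μ, ν)`-confined field-history starting from the endpoint `ε` of the loop `(μ, ν)`:
its transit states (those strictly between the initial and the final one) avoid `μ` and `ν`.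
A field-history starting from the lower endpoint `μ` begins with `U`, one starting from the upper
endpoint `ν` begins with `D`; thus `ν` is never left by `U`, nor `μ` by `D`. On a singleton loop
this leaves only the empty field-history. -/
def IsConfinedHistory (μ ν ε : S) (Φ : List AQSStep) : Prop :=
  (ε = μ ∨ ε = ν) ∧
  (Φ.head? = some .up → ε ≠ ν) ∧
  (Φ.head? = some .down → ε ≠ μ) ∧
  ∀ k : ℕ, 0 < k → k < Φ.length → A.run (Φ.take k) ε ≠ μ ∧ A.run (Φ.take k) ε ≠ ν

/-- The set `R_{μ,ν}` of `(μ, ν)`-reachable states. -/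
def reachable (μ ν : S) : Set S :=
  {σ | ∃ (ε : S) (Φ : List AQSStep), A.IsConfinedHistory μ ν ε Φ ∧ A.run Φ ε = σ}

/-- The state transition graph on a set `R` of states, as a multigraph: its vertices are the states
in `R`, and it has one edge from `σ` to `U σ` and one edge from `σ` to `D σ` for every `σ ∈ R`
for which that target is in `R` too. The edge `(σ, s)` is the transition of kind `s` out of `σ`. -/
def transitionGraph (R : Set S) : Graph S (S × AQSStep) where
  vertexSet := R
  IsLink e x y := x ∈ R ∧ y ∈ R ∧
    ((x = e.1 ∧ y = A.step e.2 e.1) ∨ (y = e.1 ∧ x = A.step e.2 e.1))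
  isLink_symm _ _ := ⟨fun _ _ h => ⟨h.2.1, h.1, h.2.2.symm⟩⟩
  eq_or_eq_of_isLink_of_isLink := by
    rintro e x y v w ⟨-, -, h⟩ ⟨-, -, h'⟩
    rcases h with ⟨h1, h2⟩ | ⟨h1, h2⟩ <;> rcases h' with ⟨h3, h4⟩ | ⟨h3, h4⟩ <;> simp_all
  left_mem_of_isLink := fun _ _ _ h => h.1

end AQSAutomaton

/-- A drawing of a multigraph in the Euclidean plane without crossings. Vertices are distinct points
and every edge is a continuous curve joining the points of its ends. The interior of an edge contains
no vertex and does not meet itself or the interior of another edge. Hence edges with distinct ends are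
simple arcs, and edges from a vertex to itself are simple closed curves. -/
structure PlaneDrawing {α β : Type*} (G : Graph α β) where
  point : α → EuclideanSpace ℝ (Fin 2)
  curve : β → C(unitInterval, EuclideanSpace ℝ (Fin 2))
  point_injOn : Set.InjOn point G.vertexSet
  curve_ends : ∀ e ∈ G.edgeSet, ∃ x y, G.IsLink e x y ∧ curve e 0 = point x ∧ curve e 1 = point y
  curve_ne_point : ∀ e ∈ G.edgeSet, ∀ t ∈ Set.Ioo (0 : unitInterval) 1, ∀ x ∈ G.vertexSet,
    curve e t ≠ point x
  curve_inj : ∀ e ∈ G.edgeSet, ∀ f ∈ G.edgeSet,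
    ∀ s ∈ Set.Ioo (0 : unitInterval) 1, ∀ t ∈ Set.Ioo (0 : unitInterval) 1,
      curve e s = curve f t → e = f ∧ s = t

/-- A multigraph is planar if it can be drawn in the plane without crossings. -/
def Graph.IsPlanar {α β : Type*} (G : Graph α β) : Prop := Nonempty (PlaneDrawing G)

/-!
A loop `(μ, ν)` with `μ ≠ ν` splits into two smaller loops: `(μ, π)` with `U π = ν`, and `(κ, ν)`,
where `κ` is the last state on the `D`-orbit of `ν` before this orbit enters the first loop. By
induction, the states of a loop can be listed on a line so that every `U`-transition goes forward
to a state on the `U`-orbit of the next entry, and every `D`-transition goes backward to a state on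
the `D`-orbit of the previous entry. By antisymmetry of the dynamic orders, the `U`-arcs then do not
cross each other, and neither do the `D`-arcs. Drawing the former above the line and the latter
below it gives a two-page book embedding, hence a plane drawing.
-/

section Orbits

variable {S : Type*} {f : S → S}

/-- The state `y` lies on the forward orbit of `x` under `f`: this is `x ⪯_U y` for `f = U`
and `y ⪯_D x` for `f = D`. -/
abbrev Reaches (f : S → S) : S → S → Prop :=
  Relation.ReflTransGen fun x y => f x = y

theorem reaches_iff_exists_iterate {x y : S} : Reaches f x y ↔ ∃ n : ℕ, y = f^[n] x := by
  constructor
  · intro h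
    induction h using Relation.ReflTransGen.head_induction_on with
    | refl => exact ⟨0, rfl⟩
    | head hab _ ih =>
      obtain ⟨n, rfl⟩ := ih
      exact ⟨n + 1, hab ▸ rfl⟩
  · rintro ⟨n, rfl⟩
    induction n with
    | zero => exact .refl
    | succ n ih => exact ih.tail (Function.iterate_succ_apply' f n x).symm

namespace Reaches

theorem apply_self (x : S) : Reaches f x (f x) :=
  .single rfl

theorem apply_of_ne {x y : S} (h : Reaches f x y) (hne : x ≠ y) : Reaches f (f x) y := by
  obtain rfl | ⟨_, rfl, h⟩ := h.cases_head
  exacts [absurd rfl hne, h]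

theorem exists_entry {T : Set S} {x y : S} (h : Reaches f x y) (hx : x ∉ T) (hy : y ∈ T) :
    ∃ z, Reaches f x z ∧ z ∉ T ∧ f z ∈ T ∧ Reaches f (f z) y := by
  induction h using Relation.ReflTransGen.head_induction_on with
  | refl => exact absurd hy hx
  | @head a c hac hcy ih =>
    by_cases hc : c ∈ T
    · exact ⟨a, .refl, hx, hac ▸ hc, hac ▸ hcy⟩
    · obtain ⟨z, hcz, hz⟩ := ih hc
      exact ⟨z, hcz.head hac, hz⟩

theorem antisymm_of_lt_apply {β : Type*} [Preorder β] (φ : S → β)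
    (hφ : ∀ x, f x ≠ x → φ x < φ (f x)) : Std.Antisymm (Reaches f) := by
  have hlt {x y : S} (h : Reaches f x y) : x = y ∨ φ x < φ y := by
    induction h with
    | refl => exact .inl rfl
    | @tail b c _ hbc ih =>
      obtain rfl | hne := eq_or_ne b c
      · exact ih
      · have hφb : φ b < φ c := hbc ▸ hφ b (hbc ▸ hne.symm)
        exact .inr (ih.elim (· ▸ hφb) (·.trans hφb))
  refine ⟨fun x y hxy hyx => ?_⟩
  obtain rfl | hxy := hlt hxy
  · rfl
  · exact (hlt hyx).elim Eq.symm fun hyx => absurd hyx hxy.asymm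

theorem wellFounded_and_ne [Finite S] [Std.Antisymm (Reaches f)] :
    WellFounded fun x y => Reaches f x y ∧ x ≠ y := by
  have : IsTrans S fun x y => Reaches f x y ∧ x ≠ y :=
    ⟨fun x y z hxy hyz => ⟨hxy.1.trans hyz.1, by
      rintro rfl
      exact hxy.2 (antisymm hxy.1 hyz.1)⟩⟩
  have : Std.Irrefl fun x y => Reaches f x y ∧ x ≠ y := ⟨fun _ h => h.2 rfl⟩
  exact Finite.wellFounded_of_trans_of_irrefl _

end Reaches

/-- One page of a book drawing: the states in the list `l`, from its first entry `a` to its last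
entry `t`, are placed on a line in this order, and an arc joins each `x ≠ t` to `f x`. The arcs go
forward and do not cross because each image `f x` lies on the orbit of the entry after `x`. -/
inductive IsPage (f : S → S) : S → S → List S → Prop
  | singleton (t : S) : IsPage f t t [t]
  | cons {a b t : S} {l : List S} :
      IsPage f b t l → f a ∈ l → Reaches f b (f a) → IsPage f a t (a :: l)

namespace IsPage

variable {a b b' c c' p t x : S} {l l' : List S}

theorem first_mem (h : IsPage f a t l) : a ∈ l := by
  cases h <;> simp

theorem last_mem (h : IsPage f a t l) : t ∈ l := by
  induction h with
  | singleton => simp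
  | cons _ _ _ ih => exact List.mem_cons_of_mem _ ih

theorem append (h : IsPage f a p l) (h' : IsPage f b t l') (hp : f p ∈ l')
    (hbp : Reaches f b (f p)) : IsPage f a t (l ++ l') := by
  induction h with
  | singleton => exact .cons h' hp hbp
  | cons _ ha hba ih => exact .cons (ih hp hbp) (List.mem_append_left _ ha) hba

theorem apply_mem (h : IsPage f a t l) (hx : x ∈ l) (hxt : x ≠ t) : f x ∈ l := by
  induction h with
  | singleton => exact absurd (List.mem_singleton.1 hx) hxt
  | cons _ ha _ ih =>
    obtain rfl | hx := List.mem_cons.1 hx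
    exacts [List.mem_cons_of_mem _ ha, List.mem_cons_of_mem _ (ih hx hxt)]

theorem reaches_last (h : IsPage f a t l) (hx : x ∈ l) : Reaches f x t := by
  induction h generalizing x with
  | singleton => exact List.mem_singleton.1 hx ▸ .refl
  | cons _ ha _ ih =>
    obtain rfl | hx := List.mem_cons.1 hx
    exacts [(ih ha).head rfl, ih hx]

theorem mem_of_reaches [Std.Antisymm (Reaches f)] (h : IsPage f a t l) (hx : x ∈ l)
    (hxy : Reaches f x c) (hct : Reaches f c t) : c ∈ l := by
  by_contra hc
  obtain ⟨z, -, hz, hfz, hfzc⟩ := hxy.exists_entry (T := {y | y ∉ l}) (not_not_intro hx) hc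
  have hzt : z = t := by
    by_contra hzt
    exact hfz (h.apply_mem (not_not.1 hz) hzt)
  have hzc : Reaches f t c := hzt ▸ hfzc.head rfl
  exact hc (antisymm hzc hct ▸ h.last_mem)

section Rank

variable {β : Type*} [Preorder β] {r : S → β}

theorem rank_lt_apply (h : IsPage f a t l) (hr : l.Pairwise (r · < r ·)) (hx : x ∈ l)
    (hxt : x ≠ t) : r x < r (f x) := by
  induction h with
  | singleton => exact absurd (List.mem_singleton.1 hx) hxt
  | cons _ ha _ ih =>
    obtain ⟨hlt, hr⟩ := List.pairwise_cons.1 hr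
    obtain rfl | hx := List.mem_cons.1 hx
    exacts [hlt _ ha, ih hr hx hxt]

theorem rank_le_of_reaches [Std.Antisymm (Reaches f)] (h : IsPage f a t l)
    (hr : l.Pairwise (r · < r ·)) (hb : b ∈ l) (hbc : Reaches f b c) (hc : c ∈ l) :
    r b ≤ r c := by
  induction hbc using Relation.ReflTransGen.head_induction_on with
  | refl => exact le_rfl
  | @head x y hxy hyc ih =>
    obtain rfl | hxt := eq_or_ne x t
    · have hxc : Reaches f x c := hyc.head hxy
      exact (congrArg r (antisymm hxc (h.reaches_last hc))).le
    · subst hxy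
      exact (h.rank_lt_apply hr hb hxt).le.trans (ih (h.apply_mem hb hxt))

theorem mem_tail_of_rank_lt (hr : (a :: l).Pairwise (r · < r ·)) (hb : b ∈ a :: l)
    (hc : c ∈ a :: l) (hbc : r b < r c) : c ∈ l := by
  refine (List.mem_cons.1 hc).resolve_left ?_
  rintro rfl
  obtain rfl | hb := List.mem_cons.1 hb
  exacts [lt_irrefl _ hbc, hbc.asymm (List.rel_of_pairwise_cons hr hb)]

theorem reaches_of_rank_lt (h : IsPage f a t l) (hr : l.Pairwise (r · < r ·))
    (hac : Reaches f a c) (hb : b ∈ l) (hc : c ∈ l) (hbc : r b < r c) : Reaches f b c := by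
  induction h with
  | singleton => exact absurd (mem_tail_of_rank_lt hr hb hc hbc) List.not_mem_nil
  | cons _ _ hreach ih =>
    have hc' := mem_tail_of_rank_lt hr hb hc hbc
    obtain rfl | hb := List.mem_cons.1 hb
    · exact hac
    · have hne := ne_of_apply_ne r (List.rel_of_pairwise_cons hr hc').ne
      exact ih hr.of_cons (hreach.trans (hac.apply_of_ne hne)) hb hc'

theorem reaches_apply_of_rank_lt (h : IsPage f a t l) (hr : l.Pairwise (r · < r ·)) (hb : b ∈ l)
    (hfb : f b ∈ l) (hc : c ∈ l) (hbc : r b < r c) (hcfb : r c < r (f b)) :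
    Reaches f c (f b) := by
  induction h with
  | singleton => exact absurd (mem_tail_of_rank_lt hr hb hc hbc) List.not_mem_nil
  | cons h _ hreach ih =>
    have hc' := mem_tail_of_rank_lt hr hb hc hbc
    have hfb' := mem_tail_of_rank_lt hr hc hfb hcfb
    obtain rfl | hb := List.mem_cons.1 hb
    exacts [h.reaches_of_rank_lt hr.of_cons hreach hc' hfb' hcfb, ih hr.of_cons hb hfb' hc']

theorem rank_apply_le_apply [Std.Antisymm (Reaches f)] (h : IsPage f a t l)
    (hr : l.Pairwise (r · < r ·)) (hb : b ∈ l) (hfb : f b ∈ l) (hc : c ∈ l) (hfc : f c ∈ l)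
    (hbc : r b < r c) (hcfb : r c < r (f b)) : r (f c) ≤ r (f b) := by
  have hne := ne_of_apply_ne r hcfb.ne
  exact h.rank_le_of_reaches hr hfc
    ((h.reaches_apply_of_rank_lt hr hb hfb hc hbc hcfb).apply_of_ne hne) hfb

theorem apply_eq_of_rank_lt [Std.Antisymm (Reaches f)] (h : IsPage f a t l)
    (hr : l.Pairwise (r · < r ·)) (hb : b ∈ l) (hc : c ∈ l) (hbc : f b = c ∨ f c = b)
    (hlt : r b < r c) : f b = c :=
  hbc.resolve_right fun hcb =>
    (h.rank_le_of_reaches hr hc (.single hcb) hb).not_gt hlt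

theorem not_cross [Std.Antisymm (Reaches f)] (h : IsPage f a t l) (hr : l.Pairwise (r · < r ·))
    (hb : b ∈ l) (hb' : b' ∈ l) (hc : c ∈ l) (hc' : c' ∈ l) (hbb' : f b = b' ∨ f b' = b)
    (hcc' : f c = c' ∨ f c' = c) : ¬(r b < r c ∧ r c < r b' ∧ r b' < r c') := by
  rintro ⟨hbc, hcb', hbc'⟩
  obtain rfl := h.apply_eq_of_rank_lt hr hb hb' hbb' (hbc.trans hcb')
  obtain rfl := h.apply_eq_of_rank_lt hr hc hc' hcc' (hcb'.trans hbc')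
  exact (h.rank_apply_le_apply hr hb hb' hc hc' hbc hcb').not_gt hbc'

end Rank

end IsPage

end Orbits

namespace AQSAutomaton

variable {S : Type*} {A : AQSAutomaton S} {μ ν π κ σ : S} {l l' : List S}

instance antisymm_reaches_U : Std.Antisymm (Reaches A.U) :=
  Reaches.antisymm_of_lt_apply A.Fplus A.Fplus_lt_Fplus_U

instance antisymm_reaches_D : Std.Antisymm (Reaches A.D) :=
  Reaches.antisymm_of_lt_apply (OrderDual.toDual ∘ A.Fminus) A.Fminus_D_lt_Fminus

theorem isLoop_iff_reaches : A.IsLoop μ ν ↔ Reaches A.U μ ν ∧ Reaches A.D ν μ :=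
  and_congr reaches_iff_exists_iterate.symm reaches_iff_exists_iterate.symm

namespace HasLoopRPM

theorem isLoop_of_reaches_U (hA : A.HasLoopRPM) (h : A.IsLoop μ ν) (hμσ : Reaches A.U μ σ)
    (hσν : Reaches A.U σ ν) : A.IsLoop μ σ := by
  obtain rfl | hne_μ := eq_or_ne μ σ
  · exact isLoop_iff_reaches.2 ⟨.refl, .refl⟩
  obtain rfl | hne_ν := eq_or_ne σ ν
  · exact h
  have hne : μ ≠ ν := by
    rintro rfl
    exact hne_μ (antisymm hμσ hσν)
  have hlt := (hA μ ν σ ⟨⟨h.1, hne⟩, h.2, hne⟩).1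
    ⟨reaches_iff_exists_iterate.1 hμσ, hne_μ⟩ ⟨reaches_iff_exists_iterate.1 hσν, hne_ν⟩
  exact ⟨hlt.1.1, hlt.2.1⟩

theorem isLoop_of_reaches_D (hA : A.HasLoopRPM) (h : A.IsLoop μ ν) (hνσ : Reaches A.D ν σ)
    (hσμ : Reaches A.D σ μ) : A.IsLoop σ ν := by
  obtain rfl | hne_μ := eq_or_ne μ σ
  · exact h
  obtain rfl | hne_ν := eq_or_ne σ ν
  · exact isLoop_iff_reaches.2 ⟨.refl, .refl⟩
  have hne : μ ≠ ν := by
    rintro rfl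
    exact hne_μ (antisymm hνσ hσμ)
  have hlt := (hA μ ν σ ⟨⟨h.1, hne⟩, h.2, hne⟩).2
    ⟨reaches_iff_exists_iterate.1 hσμ, hne_μ⟩ ⟨reaches_iff_exists_iterate.1 hνσ, hne_ν⟩
  exact ⟨hlt.1.1, hlt.2.1⟩

end HasLoopRPM

/-- The list `l` is the spine of a two-page book drawing of the loop `(μ, ν)`: it runs from `μ` to
`ν`, with the `U`-transitions on one page and the `D`-transitions, which go backward, on the
other. -/
structure IsSpine (A : AQSAutomaton S) (μ ν : S) (l : List S) : Prop where
  nodup : l.Nodup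
  upper : IsPage A.U μ ν l
  lower : IsPage A.D ν μ l.reverse

namespace IsSpine

theorem singleton (μ : S) : A.IsSpine μ μ [μ] :=
  ⟨List.nodup_singleton μ, .singleton μ, .singleton μ⟩

theorem append (h : A.IsSpine μ π l) (h' : A.IsSpine κ ν l') (hdisj : l.Disjoint l')
    (hU : A.U π ∈ l') (hκU : Reaches A.U κ (A.U π)) (hD : A.D κ ∈ l)
    (hπD : Reaches A.D π (A.D κ)) : A.IsSpine μ ν (l ++ l') where
  nodup := h.nodup.append h'.nodup hdisj
  upper := h.upper.append h'.upper hU hκU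
  lower := List.reverse_append ▸ h'.lower.append h.lower (List.mem_reverse.2 hD) hπD

theorem reaches_top (h : A.IsSpine μ ν l) (hσ : σ ∈ l) : Reaches A.U σ ν :=
  h.upper.reaches_last hσ

theorem reaches_bot (h : A.IsSpine μ ν l) (hσ : σ ∈ l) : Reaches A.D σ μ :=
  h.lower.reaches_last (List.mem_reverse.2 hσ)

theorem disjoint_of_reaches (h : A.IsSpine μ π l) (h' : A.IsSpine κ ν l') (hκ : κ ∉ l)
    (hκμ : Reaches A.D κ μ) : l.Disjoint l' := fun _ hσ hσ' =>
  hκ (List.mem_reverse.1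
    (h.lower.mem_of_reaches (List.mem_reverse.2 hσ) (h'.reaches_bot hσ') hκμ))

end IsSpine

theorem IsLoop.exists_isSpine (hA : A.HasLoopRPM) (hloop : A.IsLoop μ ν) :
    ∃ l, A.IsSpine μ ν l := by
  have := A.finite
  induction μ, ν using Prod.GameAdd.recursion
    (Reaches.wellFounded_and_ne (f := A.D)) (Reaches.wellFounded_and_ne (f := A.U)) with
  | IH μ ν ih =>
  obtain rfl | hne := eq_or_ne μ ν
  · exact ⟨_, .singleton μ⟩
  obtain ⟨hμν, hνμ⟩ := isLoop_iff_reaches.1 hloop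
  obtain ⟨π, hμπ, hπ_ne, hπU, -⟩ := hμν.exists_entry (T := {ν}) hne rfl
  obtain rfl : A.U π = ν := hπU
  have hπν := Reaches.apply_self (f := A.U) π
  have hloop_π : A.IsLoop μ π := hA.isLoop_of_reaches_U hloop hμπ hπν
  obtain ⟨l, hl⟩ := ih μ π (.snd ⟨hπν, hπ_ne⟩) hloop_π
  have hν : A.U π ∉ l := fun hν => hπ_ne (antisymm hπν (hl.reaches_top hν))
  obtain ⟨κ, hνκ, hκ, hκD, hDκμ⟩ := hνμ.exists_entry (T := {σ | σ ∈ l}) hν hl.upper.first_mem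
  have hκμ : Reaches A.D κ μ := hDκμ.head rfl
  have hloop_κ : A.IsLoop κ (A.U π) := hA.isLoop_of_reaches_D hloop hνκ hκμ
  have hκ_ne : κ ≠ μ := fun h => hκ (h ▸ hl.upper.first_mem)
  obtain ⟨l', hl'⟩ := ih κ (A.U π) (.fst ⟨hκμ, hκ_ne⟩) hloop_κ
  have hloop_Dκν : A.IsLoop (A.D κ) (A.U π) :=
    hA.isLoop_of_reaches_D hloop (hνκ.tail rfl) hDκμ
  have hloop_Dκπ : A.IsLoop (A.D κ) π :=
    hA.isLoop_of_reaches_U hloop_Dκν (hl.reaches_top hκD) hπν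
  exact ⟨l ++ l', hl.append hl' (hl.disjoint_of_reaches hl' hκ hκμ) hl'.upper.last_mem
    (isLoop_iff_reaches.1 hloop_κ).1 hκD (isLoop_iff_reaches.1 hloop_Dκπ).2⟩

theorem run_take_succ (Φ : List AQSStep) (σ : S) {k : ℕ} (hk : k < Φ.length) :
    A.run (Φ.take (k + 1)) σ = A.step Φ[k] (A.run (Φ.take k) σ) := by
  simp only [run, List.take_succ_eq_append_getElem hk, List.foldl_append, List.foldl_cons,
    List.foldl_nil]

theorem reachable_subset_of_mapsTo {T : Set S} (hμ : μ ∈ T) (hν : ν ∈ T)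
    (hU : Set.MapsTo A.U (T \ {ν}) T) (hD : Set.MapsTo A.D (T \ {μ}) T) :
    A.reachable μ ν ⊆ T := by
  rintro _ ⟨ε, Φ, ⟨hε, hup, hdown, htransit⟩, rfl⟩
  have hrun : ∀ k ≤ Φ.length, A.run (Φ.take k) ε ∈ T := by
    intro k hk
    induction k with
    | zero => exact hε.elim (· ▸ hμ) (· ▸ hν)
    | succ k ih =>
      have hhead : k = 0 → Φ.head? = some Φ[k] := by
        rintro rfl
        rw [List.head?_eq_getElem?, List.getElem?_eq_getElem hk]
      rw [run_take_succ Φ ε hk]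
      cases hs : Φ[k] with
      | up =>
        refine hU ⟨ih (by omega), fun hrunν => ?_⟩
        obtain rfl | hpos := Nat.eq_zero_or_pos k
        exacts [hup (hs ▸ hhead rfl) hrunν, (htransit k hpos hk).2 hrunν]
      | down =>
        refine hD ⟨ih (by omega), fun hrunμ => ?_⟩
        obtain rfl | hpos := Nat.eq_zero_or_pos k
        exacts [hdown (hs ▸ hhead rfl) hrunμ, (htransit k hpos hk).1 hrunμ]
  simpa using hrun _ le_rfl

theorem IsSpine.reachable_subset (h : A.IsSpine μ ν l) : A.reachable μ ν ⊆ {σ | σ ∈ l} :=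
  reachable_subset_of_mapsTo h.upper.first_mem h.upper.last_mem
    (fun _ hσ => h.upper.apply_mem hσ.1 hσ.2)
    (fun _ hσ => List.mem_reverse.1 (h.lower.apply_mem (List.mem_reverse.2 hσ.1) hσ.2))

end AQSAutomaton

section BookDrawing

/-- The first coordinate of the curve on a page that joins the spine positions `m ≤ n`. For `m = n`
the curve is a closed loop that lies between `m` and `m + 1`. -/
noncomputable def pageAbscissa (m n : ℤ) (t : ℝ) : ℝ :=
  if m = n then m + t * (1 - t) else m + t * (n - m)

/-- The height above the spine of the curve on a page that joins the spine positions `m ≤ n`. For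
`m < n` this curve is the parabola `y = (x - m) * (n - x)`, so nested intervals have nested curves.
For `m = n` the factor `1 + t` tells apart the parameters `t` and `1 - t`, which have the same
abscissa, and the factor `1 / 4` keeps the loop below the arc from `m` to `m + 1`. -/
noncomputable def pageHeight (m n : ℤ) (t : ℝ) : ℝ :=
  if m = n then t * (1 - t) * (1 + t) / 4 else t * (1 - t) * (n - m) ^ 2

variable {m n m' n' : ℤ} {s t : ℝ}

theorem pageHeight_pos (ht : t ∈ Set.Ioo 0 1) : 0 < pageHeight m n t := by
  obtain ⟨ht₀, ht₁⟩ := ht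
  have : 0 < t * (1 - t) := mul_pos ht₀ (sub_pos.2 ht₁)
  unfold pageHeight
  split_ifs with hmn
  · positivity
  · have : (n - m : ℝ) ≠ 0 := sub_ne_zero.2 (by exact_mod_cast Ne.symm hmn)
    positivity

theorem lt_pageAbscissa (hmn : m ≤ n) (ht : t ∈ Set.Ioo 0 1) : (m : ℝ) < pageAbscissa m n t := by
  obtain ⟨ht₀, ht₁⟩ := ht
  unfold pageAbscissa
  split_ifs with h
  · linarith [mul_pos ht₀ (sub_pos.2 ht₁)]
  · have : (m : ℝ) < n := by exact_mod_cast hmn.lt_of_ne h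
    linarith [mul_pos ht₀ (sub_pos.2 this)]

theorem pageAbscissa_lt (hmn : m < n) (ht : t < 1) : pageAbscissa m n t < n := by
  have hmn' : (m : ℝ) < n := by exact_mod_cast hmn
  rw [pageAbscissa, if_neg hmn.ne]
  linarith [mul_pos (sub_pos.2 ht) (sub_pos.2 hmn')]

theorem pageAbscissa_self_lt (m : ℤ) (t : ℝ) : pageAbscissa m m t < m + 1 := by
  rw [pageAbscissa, if_pos rfl]
  linarith [sq_nonneg (t - 1 / 2)]

theorem pageHeight_eq_of_ne (hmn : m ≠ n) (t : ℝ) :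
    pageHeight m n t = (pageAbscissa m n t - m) * (n - pageAbscissa m n t) := by
  rw [pageHeight, pageAbscissa, if_neg hmn, if_neg hmn]
  ring

theorem pageHeight_self_lt (m : ℤ) (ht : t ∈ Set.Ioo 0 1) :
    pageHeight m m t < (pageAbscissa m m t - m) * (m + 1 - pageAbscissa m m t) := by
  obtain ⟨ht₀, ht₁⟩ := ht
  have hpos : 0 < t * (1 - t) := mul_pos ht₀ (sub_pos.2 ht₁)
  have hheight : t * (1 - t) * ((1 + t) / 4) < t * (1 - t) * (1 - t * (1 - t)) :=
    mul_lt_mul_of_pos_left (by nlinarith [sq_nonneg (t - 1 / 2)]) hpos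
  rw [pageHeight, pageAbscissa, if_pos rfl, if_pos rfl]
  linarith

theorem mul_sub_lt_mul_sub_of_nested {𝕜 : Type*} [CommRing 𝕜] [LinearOrder 𝕜]
    [IsStrictOrderedRing 𝕜] {a b a' b' x : 𝕜} (ha : a ≤ a') (hb : b' ≤ b) (hne : a ≠ a' ∨ b' ≠ b)
    (hax : a' < x) (hxb : x < b') :
    (x - a') * (b' - x) < (x - a) * (b - x) := by
  have : 0 < x - a' := sub_pos.2 hax
  have hx' : 0 < b' - x := sub_pos.2 hxb
  obtain hne | hne := hne
  · exact mul_lt_mul (sub_lt_sub_left (ha.lt_of_ne hne) x) (sub_le_sub_right hb x) hx'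
      (by linarith)
  · exact mul_lt_mul' (sub_le_sub_left ha x) (sub_lt_sub_right (hb.lt_of_ne hne) x) hx'.le
      (by linarith)

theorem pageHeight_lt_of_nested (hm : m ≤ m') (hmn' : m' ≤ n') (hn : n' ≤ n) (hlt : m' < n)
    (hne : m ≠ m' ∨ n' ≠ n) (ht : t ∈ Set.Ioo 0 1) :
    pageHeight m' n' t < (pageAbscissa m' n' t - m) * (n - pageAbscissa m' n' t) := by
  have hmR : (m : ℝ) ≤ m' := by exact_mod_cast hm
  obtain rfl | hlt' := hmn'.eq_or_lt
  · have hnR : (m' : ℝ) + 1 ≤ n := by exact_mod_cast hlt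
    have hleft := lt_pageAbscissa le_rfl ht (m := m')
    have hright := pageAbscissa_self_lt m' t
    refine (pageHeight_self_lt m' ht).trans_le ?_
    gcongr
    linarith
  · rw [pageHeight_eq_of_ne hlt'.ne]
    exact mul_sub_lt_mul_sub_of_nested hmR (by exact_mod_cast hn) (by exact_mod_cast hne)
      (lt_pageAbscissa hmn' ht) (pageAbscissa_lt hlt' ht.2)

theorem eq_of_page_eq (hs : s ∈ Set.Ioo 0 1)
    (habscissa : pageAbscissa m n s = pageAbscissa m n t)
    (hheight : pageHeight m n s = pageHeight m n t) : s = t := by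
  unfold pageAbscissa at habscissa
  unfold pageHeight at hheight
  split_ifs at habscissa hheight with h
  · have hpos : s * (1 - s) ≠ 0 := (mul_pos hs.1 (sub_pos.2 hs.2)).ne'
    have hst : s * (1 - s) = t * (1 - t) := add_left_cancel habscissa
    rw [← hst] at hheight
    exact mul_left_cancel₀ hpos (by linarith)
  · have : (n - m : ℝ) ≠ 0 := sub_ne_zero.2 (by exact_mod_cast Ne.symm h)
    exact mul_right_cancel₀ this (add_left_cancel habscissa)

theorem pageHeight_ne_of_lex_lt (hmn : m ≤ n) (hmn' : m' ≤ n')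
    (hcross : ¬(m < m' ∧ m' < n ∧ n < n')) (hlex : m < m' ∨ m = m' ∧ n' < n)
    (hs : s ∈ Set.Ioo 0 1) (ht : t ∈ Set.Ioo 0 1)
    (habscissa : pageAbscissa m n s = pageAbscissa m' n' t) :
    pageHeight m n s ≠ pageHeight m' n' t := by
  have hm'n : m' < n := by
    by_contra! hnm'
    have hm : m < m' := by omega
    have hleft := lt_pageAbscissa hmn' ht
    obtain rfl | hlt := hmn.eq_or_lt
    · have : (m : ℝ) + 1 ≤ m' := by exact_mod_cast hm
      linarith [pageAbscissa_self_lt m s]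
    · have : (n : ℝ) ≤ m' := by exact_mod_cast hnm'
      linarith [pageAbscissa_lt hlt hs.2]
  have hnest := pageHeight_lt_of_nested (m := m) (n := n) (by omega) hmn' (by omega) hm'n
    (by omega) ht
  rw [pageHeight_eq_of_ne (by omega), habscissa]
  exact hnest.ne'

theorem pageHeight_ne_of_not_cross (hmn : m ≤ n) (hmn' : m' ≤ n') (hne : ¬(m = m' ∧ n = n'))
    (hcross : ¬(m < m' ∧ m' < n ∧ n < n')) (hcross' : ¬(m' < m ∧ m < n' ∧ n' < n))
    (hs : s ∈ Set.Ioo 0 1) (ht : t ∈ Set.Ioo 0 1)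
    (habscissa : pageAbscissa m n s = pageAbscissa m' n' t) :
    pageHeight m n s ≠ pageHeight m' n' t := by
  obtain hlex | hlex : (m < m' ∨ m = m' ∧ n' < n) ∨ (m' < m ∨ m' = m ∧ n < n') := by omega
  · exact pageHeight_ne_of_lex_lt hmn hmn' hcross hlex hs ht habscissa
  · exact (pageHeight_ne_of_lex_lt hmn' hmn hcross' hlex ht hs habscissa.symm).symm

theorem vec_two_inj {a b c d : ℝ} :
    (!₂[a, b] : EuclideanSpace ℝ (Fin 2)) = !₂[c, d] ↔ a = c ∧ b = d := by
  simp

theorem continuous_pageAbscissa (m n : ℤ) : Continuous (pageAbscissa m n) := by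
  unfold pageAbscissa
  split_ifs <;> fun_prop

theorem continuous_pageHeight (m n : ℤ) : Continuous (pageHeight m n) := by
  unfold pageHeight
  split_ifs <;> fun_prop

/-- The curve that joins the points `m` and `n` of the horizontal axis in the upper half-plane if
`ε = 1` and in the lower one if `ε = -1`. -/
noncomputable def bookCurve (ε : ℤˣ) (m n : ℤ) : C(unitInterval, EuclideanSpace ℝ (Fin 2)) where
  toFun t := !₂[pageAbscissa m n t, (ε : ℤ) * pageHeight m n t]
  continuous_toFun := by
    refine (PiLp.continuous_toLp 2 _).comp (continuous_pi (Fin.forall_fin_two.2 ⟨?_, ?_⟩))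
    · exact (continuous_pageAbscissa m n).comp continuous_subtype_val
    · exact ((continuous_pageHeight m n).comp continuous_subtype_val).const_mul _

theorem bookCurve_zero (ε : ℤˣ) (m n : ℤ) : bookCurve ε m n 0 = !₂[(m : ℝ), 0] := by
  simp [bookCurve, pageAbscissa, pageHeight]

theorem bookCurve_one (ε : ℤˣ) (m n : ℤ) : bookCurve ε m n 1 = !₂[(n : ℝ), 0] := by
  by_cases h : m = n <;> simp [bookCurve, pageAbscissa, pageHeight, h]

theorem units_eq_of_mul_eq_mul {𝕜 : Type*} [CommRing 𝕜] [LinearOrder 𝕜]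
    [IsStrictOrderedRing 𝕜] {ε ε' : ℤˣ} {x y : 𝕜} (hx : 0 < x) (hy : 0 < y)
    (h : (ε : ℤ) * x = (ε' : ℤ) * y) : ε = ε' := by
  obtain rfl | rfl := Int.units_eq_one_or ε <;> obtain rfl | rfl := Int.units_eq_one_or ε'
  · rfl
  · simp only [Units.val_one, Units.val_neg, Int.cast_one, Int.cast_neg] at h
    linarith
  · simp only [Units.val_one, Units.val_neg, Int.cast_one, Int.cast_neg] at h
    linarith
  · rfl

end BookDrawing

/-- A two-page book embedding of the multigraph `G`: the vertices are placed on a line by `r`, each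
edge is assigned to one of two pages by `side`, and no two edges on the same page cross or are
parallel. -/
structure IsTwoPageEmbedding {α β : Type*} (G : Graph α β) (r : α → ℤ) (side : β → ℤˣ) : Prop where
  injOn : Set.InjOn r G.vertexSet
  not_cross : ∀ {e f a b c d}, G.IsLink e a b → G.IsLink f c d → side e = side f →
    ¬(r a < r c ∧ r c < r b ∧ r b < r d)
  eq_of_isLink : ∀ {e f a b}, G.IsLink e a b → G.IsLink f a b → side e = side f → e = f

namespace IsTwoPageEmbedding

variable {α β : Type*} {G : Graph α β} {r : α → ℤ} {side : β → ℤˣ}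

theorem eq_of_bookCurve_eq (h : IsTwoPageEmbedding G r side) {e f : β} {a b c d : α}
    (he : G.IsLink e a b) (hf : G.IsLink f c d) (hab : r a ≤ r b) (hcd : r c ≤ r d)
    {s t : unitInterval} (hs : s ∈ Set.Ioo 0 1) (ht : t ∈ Set.Ioo 0 1)
    (hst : bookCurve (side e) (r a) (r b) s = bookCurve (side f) (r c) (r d) t) :
    e = f ∧ s = t := by
  obtain ⟨habscissa, hheight⟩ := vec_two_inj.1 hst
  have hside : side e = side f :=
    units_eq_of_mul_eq_mul (pageHeight_pos hs) (pageHeight_pos ht) hheight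
  rw [hside] at hheight
  have hheight := mul_left_cancel₀ (by simp) hheight
  obtain ⟨hac, hbd⟩ : r a = r c ∧ r b = r d := by
    by_contra hne
    exact pageHeight_ne_of_not_cross hab hcd hne (h.not_cross he hf hside)
      (h.not_cross hf he hside.symm) hs ht habscissa hheight
  obtain rfl := h.injOn he.left_mem hf.left_mem hac
  obtain rfl := h.injOn he.right_mem hf.right_mem hbd
  exact ⟨h.eq_of_isLink he hf hside, Subtype.ext (eq_of_page_eq hs habscissa hheight)⟩

theorem isPlanar (h : IsTwoPageEmbedding G r side) : G.IsPlanar := by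
  have hends : ∀ e, ∃ m n : ℤ, e ∈ G.edgeSet →
      ∃ a b, G.IsLink e a b ∧ r a = m ∧ r b = n ∧ m ≤ n := by
    intro e
    by_cases he : e ∈ G.edgeSet
    · obtain ⟨a, b, hab⟩ := G.exists_isLink_of_mem_edgeSet he
      obtain hle | hle := le_total (r a) (r b)
      · exact ⟨r a, r b, fun _ => ⟨a, b, hab, rfl, rfl, hle⟩⟩
      · exact ⟨r b, r a, fun _ => ⟨b, a, hab.symm, rfl, rfl, hle⟩⟩
    · exact ⟨0, 0, fun he' => absurd he' he⟩
  choose m n hmn using hends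
  refine ⟨{
    point := fun a => !₂[(r a : ℝ), 0]
    curve := fun e => bookCurve (side e) (m e) (n e)
    point_injOn := fun a ha b hb hab =>
      h.injOn ha hb (Int.cast_injective (vec_two_inj.1 hab).1)
    curve_ends := fun e he => ?_
    curve_ne_point := fun e _ t ht a _ hta => ?_
    curve_inj := fun e he f hf s hs t ht hst => ?_ }⟩
  · obtain ⟨a, b, hab, ha, hb, -⟩ := hmn e he
    exact ⟨a, b, hab, ha ▸ bookCurve_zero _ _ _, hb ▸ bookCurve_one _ _ _⟩
  · have hheight : ((side e : ℤ) : ℝ) * pageHeight (m e) (n e) t = 0 := (vec_two_inj.1 hta).2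
    exact mul_ne_zero (by simp) (pageHeight_pos ht).ne' hheight
  · obtain ⟨a, b, hab, ha, hb, hle⟩ := hmn e he
    obtain ⟨c, d, hcd, hc, hd, hle'⟩ := hmn f hf
    rw [← ha, ← hb, ← hc, ← hd] at hst
    exact h.eq_of_bookCurve_eq hab hcd (by omega) (by omega) hs ht hst

end IsTwoPageEmbedding

/-- The page of the drawing on which the transitions of a given kind lie. -/
def AQSStep.page : AQSStep → ℤˣ
  | .up => 1
  | .down => -1

theorem AQSStep.page_injective : Function.Injective AQSStep.page := by
  rintro (_ | _) (_ | _) <;> simp [page]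

theorem pairwise_idxOf_lt {S : Type*} [DecidableEq S] {l : List S} (hl : l.Nodup) :
    l.Pairwise (l.idxOf · < l.idxOf ·) := by
  rw [List.pairwise_iff_getElem]
  intro i j hi hj hij
  rwa [hl.idxOf_getElem, hl.idxOf_getElem]

namespace AQSAutomaton

variable {S : Type*} {A : AQSAutomaton S} {μ ν : S} {l : List S} {R : Set S}

instance antisymm_reaches_step : ∀ s, Std.Antisymm (Reaches (A.step s))
  | .up => A.antisymm_reaches_U
  | .down => A.antisymm_reaches_D

theorem step_eq_of_isLink {e : S × AQSStep} {σ τ : S} (h : (A.transitionGraph R).IsLink e σ τ) :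
    A.step e.2 σ = τ ∨ A.step e.2 τ = σ := by
  obtain ⟨-, -, ⟨rfl, rfl⟩ | ⟨rfl, rfl⟩⟩ := h
  exacts [.inl rfl, .inr rfl]

theorem eq_of_isLink_of_isLink {σ τ x y : S} {s : AQSStep}
    (hσ : (A.transitionGraph R).IsLink (σ, s) x y)
    (hτ : (A.transitionGraph R).IsLink (τ, s) x y) : σ = τ := by
  have eq_of_swap {x y : S} (hxy : x = A.step s y) (hyx : y = A.step s x) : x = y :=
    antisymm (r := Reaches (A.step s)) (.single hyx.symm) (.single hxy.symm)
  obtain ⟨-, -, ⟨hx, hy⟩ | ⟨hy, hx⟩⟩ := hσ <;> obtain ⟨-, -, ⟨hx', hy'⟩ | ⟨hy', hx'⟩⟩ := hτ <;>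
    dsimp only at hx hy hx' hy' <;> subst hx hy
  · exact hx'
  · exact eq_of_swap (hy' ▸ hx') hy'.symm
  · exact eq_of_swap (hx' ▸ hy') hx'.symm
  · exact hy'

theorem IsSpine.not_cross [DecidableEq S] (h : A.IsSpine μ ν l) (hR : R ⊆ {σ | σ ∈ l})
    {e f : S × AQSStep} {a b c d : S} (hab : (A.transitionGraph R).IsLink e a b)
    (hcd : (A.transitionGraph R).IsLink f c d) (hstep : e.2 = f.2) :
    ¬(l.idxOf a < l.idxOf c ∧ l.idxOf c < l.idxOf b ∧ l.idxOf b < l.idxOf d) := by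
  have hab' := step_eq_of_isLink hab
  have hcd' := step_eq_of_isLink hcd
  have hr := pairwise_idxOf_lt h.nodup
  rw [← hstep] at hcd'
  cases hs : e.2 with
  | up =>
    rw [hs] at hab' hcd'
    exact h.upper.not_cross hr (hR hab.1) (hR hab.2.1) (hR hcd.1) (hR hcd.2.1) hab' hcd'
  | down =>
    rw [hs] at hab' hcd'
    have hr' : l.reverse.Pairwise fun x y =>
        OrderDual.toDual (l.idxOf x) < OrderDual.toDual (l.idxOf y) :=
      List.pairwise_reverse.2 hr
    have hmem {σ : S} (hσ : σ ∈ R) : σ ∈ l.reverse := List.mem_reverse.2 (hR hσ)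
    rintro ⟨hac, hcb, hbd⟩
    exact h.lower.not_cross hr' (hmem hcd.2.1) (hmem hcd.1) (hmem hab.2.1) (hmem hab.1)
      hcd'.symm hab'.symm ⟨hbd, hcb, hac⟩

theorem IsSpine.isTwoPageEmbedding [DecidableEq S] (h : A.IsSpine μ ν l)
    (hR : R ⊆ {σ | σ ∈ l}) :
    IsTwoPageEmbedding (A.transitionGraph R) (fun σ => (l.idxOf σ : ℤ)) (fun e => e.2.page) where
  injOn σ hσ τ _ hστ := (List.idxOf_inj (hR hσ)).1 (Int.ofNat_injective hστ)
  not_cross hab hcd hpage := by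
    simpa only [Int.ofNat_lt] using h.not_cross hR hab hcd (AQSStep.page_injective hpage)
  eq_of_isLink := by
    rintro ⟨σ, s⟩ ⟨τ, s'⟩ x y hσ hτ hpage
    obtain rfl : s = s' := AQSStep.page_injective hpage
    exact congrArg (·, s) (eq_of_isLink_of_isLink hσ hτ)

end AQSAutomaton

theorem mainTheorem2 {S : Type*} (A : AQSAutomaton S) (hA : A.HasLoopRPM)
    (μ ν : S) (hloop : A.IsLoop μ ν) :
    (A.transitionGraph (A.reachable μ ν)).IsPlanar := by
  classical
  obtain ⟨l, hl⟩ := hloop.exists_isSpine hA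
  exact (hl.isTwoPageEmbedding hl.reachable_subset).isPlanar
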